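/- Let $\Gamma$ be a finite simple connected graph of diameter $D$ with distance function $d$. One says that $\Gamma$ is distance-regular with intersection array $\{b_0,b_1,\dots,b_{D-1};c_1,c_2,\dots,c_D\}$ if for all vertices $x,y$ of $\Gamma$, with $i=d(x,y)$, the vertex $y$ has exactly $b_i$ neighbours at distance $i+1$ from $x$ (when $0\le i\le D-1$) and exactly $c_i$ neighbours at distance $i-1$ from $x$ (when $1\le i\le D$). **Theorem.** There is no distance-regular graph with any of the following intersection arrays: $$\{83,54,21;1,6,63\},\quad \{104,70,25;1,7,80\},\quad \{195,160,28;1,20,168\},\quad \{125,108,24;1,9,75\},$$ $$\{126,90,10;1,6,105\},\quad \{203,160,34;1,16,170\},\quad \{53,40,28,16;1,4,10,28\}.$$ -/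

import Mathlib

/-- A finite simple graph `G` is distance-regular with intersection array
`{b₀, …, b_{D-1}; c₁, …, c_D}`: it is connected of diameter `D`, and for all vertices `x`, `y`
at distance `i`, the vertex `y` has exactly `bᵢ` neighbours at distance `i + 1` from `x`
(for `0 ≤ i ≤ D - 1`) and exactly `cᵢ` neighbours at distance `i - 1` from `x`
(for `1 ≤ i ≤ D`). The sequence `c` is indexed from `0`, so `c i` stands for `c_{i+1}`.
The condition `b_D = 0` is automatic, since the diameter is `D`. -/
structure SimpleGraph.HasIntersectionArray {V : Type*} [Finite V] (G : SimpleGraph V)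
    {D : ℕ} (b c : Fin D → ℕ) : Prop where
  connected : G.Connected
  diam_eq : G.diam = D
  card_b : ∀ (i : Fin D) (x y : V), G.dist x y = (i : ℕ) →
    {z : V | G.Adj y z ∧ G.dist x z = (i : ℕ) + 1}.ncard = b i
  card_c : ∀ (i : Fin D) (x y : V), G.dist x y = (i : ℕ) + 1 →
    {z : V | G.Adj y z ∧ G.dist x z = (i : ℕ)}.ncard = c i

open Finset

/-! The distance relations of a distance-regular graph form a symmetric association scheme whose
intersection numbers are determined by the array. Fix vertices `u`, `v`, `w` at prescribed distances
and count the vertices at distances `l`, `m`, `n` from them. Summing these triple intersection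
numbers over one index gives an intersection number. Every vanishing Krein parameter adds a further
linear equation (`sum_mul_tripleNumber_eq_zero`).

For each array some combination of these equations involves at most two triple numbers
(`linear_relation`). Six of the resulting relations have no solution in nonnegative integers within
the available bounds. For {104,70,25;1,7,80} the relation is only a lower bound on one triple
number, and a double count of edges near a fixed edge `uv` contradicts it. -/

/-- `d` assigns to each pair of elements of `V` one of `D + 1` relations, and these form a symmetric
association scheme with intersection numbers `p h i j`. -/
structure IsSymmScheme {V : Type*} [Fintype V] {D : ℕ} (d : V → V → Fin (D + 1))
    (p : Fin (D + 1) → Fin (D + 1) → Fin (D + 1) → ℤ) : Prop where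
  symm : ∀ x y, d x y = d y x
  diag : ∀ x, d x x = 0
  card : ∀ i j x y, (#{z | d x z = i ∧ d y z = j} : ℤ) = p (d x y) i j

/-- The number of elements in relations `l`, `m`, `n` with `u`, `v`, `w`. -/
def tripleNumber {V : Type*} [Fintype V] {D : ℕ} (d : V → V → Fin (D + 1)) (u v w : V)
    (l m n : Fin (D + 1)) : ℕ :=
  #{x | d u x = l ∧ d v x = m ∧ d w x = n}

/-! ### Summation identities -/

theorem sum_apply_eq_sum_card_mul {V α : Type*} [Fintype V] [Fintype α] [DecidableEq α]
    (f : V → α) (φ : α → ℤ) : ∑ x, φ (f x) = ∑ a, (#{x | f x = a} : ℤ) * φ a := by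
  have h : ∀ x, φ (f x) = ∑ a, if f x = a then φ a else 0 := fun x => by simp
  simp_rw [h]
  rw [sum_comm]
  refine sum_congr rfl fun a _ => ?_
  rw [← sum_filter, sum_const, nsmul_eq_mul]

theorem sum_sum_sum_sq_eq {V : Type*} [Fintype V] (a b c : V → V → ℤ) :
    ∑ u, ∑ v, ∑ w, (∑ x, a u x * b v x * c w x) ^ 2 =
      ∑ x, ∑ y, (∑ u, a u x * a u y) * (∑ v, b v x * b v y) * (∑ w, c w x * c w y) := by
  have h : ∀ u v w, (∑ x, a u x * b v x * c w x) ^ 2 =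
      ∑ x, ∑ y, (a u x * a u y) * (b v x * b v y) * (c w x * c w y) := fun u v w => by
    rw [sq, sum_mul_sum]
    exact sum_congr rfl fun x _ => sum_congr rfl fun y _ => by ring
  have h' : ∀ x y, (∑ u, a u x * a u y) * (∑ v, b v x * b v y) * (∑ w, c w x * c w y) =
      ∑ u, ∑ v, ∑ w, (a u x * a u y) * (b v x * b v y) * (c w x * c w y) := fun x y => by
    rw [sum_mul_sum, sum_mul]
    refine sum_congr rfl fun u _ => ?_
    rw [sum_mul]
    exact sum_congr rfl fun v _ => mul_sum ..
  simp_rw [h, h']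
  calc _ = ∑ u, ∑ v, ∑ x, ∑ w, ∑ y, (a u x * a u y) * (b v x * b v y) * (c w x * c w y) :=
        sum_congr rfl fun u _ => sum_congr rfl fun v _ => sum_comm
    _ = ∑ u, ∑ x, ∑ v, ∑ w, ∑ y, (a u x * a u y) * (b v x * b v y) * (c w x * c w y) :=
        sum_congr rfl fun u _ => sum_comm
    _ = ∑ x, ∑ u, ∑ v, ∑ w, ∑ y, (a u x * a u y) * (b v x * b v y) * (c w x * c w y) := sum_comm
    _ = ∑ x, ∑ u, ∑ v, ∑ y, ∑ w, (a u x * a u y) * (b v x * b v y) * (c w x * c w y) :=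
        sum_congr rfl fun x _ => sum_congr rfl fun u _ => sum_congr rfl fun v _ => sum_comm
    _ = ∑ x, ∑ u, ∑ y, ∑ v, ∑ w, (a u x * a u y) * (b v x * b v y) * (c w x * c w y) :=
        sum_congr rfl fun x _ => sum_congr rfl fun u _ => sum_comm
    _ = _ := sum_congr rfl fun x _ => sum_comm

/-! ### Triple intersection numbers in an association scheme -/

namespace IsSymmScheme

variable {V : Type*} [Fintype V] {D : ℕ} {d : V → V → Fin (D + 1)}
  {p : Fin (D + 1) → Fin (D + 1) → Fin (D + 1) → ℤ}

theorem sum_apply_apply (hS : IsSymmScheme d p) (φ : Fin (D + 1) → Fin (D + 1) → ℤ) (x y : V) :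
    ∑ z, φ (d x z) (d y z) = ∑ i, ∑ j, p (d x y) i j * φ i j := by
  rw [sum_apply_eq_sum_card_mul (fun z => (d x z, d y z)) (fun a => φ a.1 a.2),
    Fintype.sum_prod_type]
  refine sum_congr rfl fun i _ => sum_congr rfl fun j _ => ?_
  simp only [Prod.mk.injEq, hS.card]

theorem sum_apply (hS : IsSymmScheme d p) (φ : Fin (D + 1) → ℤ) (x : V) :
    ∑ z, φ (d x z) = ∑ i, p 0 i i * φ i := by
  rw [sum_apply_eq_sum_card_mul (d x) φ]
  refine sum_congr rfl fun i _ => ?_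
  rw [← hS.diag x, ← hS.card]
  simp only [and_self]

theorem exists_of_pos (hS : IsSymmScheme d p) {x y : V} {i j : Fin (D + 1)}
    (h : 0 < p (d x y) i j) : ∃ z, d x z = i ∧ d y z = j := by
  rw [← hS.card, Nat.cast_pos, card_pos] at h
  obtain ⟨z, hz⟩ := h
  exact ⟨z, by simpa using hz⟩

theorem exists_triple (hS : IsSymmScheme d p) [Nonempty V] {A B C : Fin (D + 1)}
    (hA : 0 < p 0 A A) (h : 0 < p A B C) : ∃ u v w, d u v = A ∧ d u w = B ∧ d v w = C := by
  obtain ⟨u⟩ := ‹Nonempty V›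
  obtain ⟨v, hv, -⟩ := hS.exists_of_pos (x := u) (y := u) (i := A) (j := A) (by rwa [hS.diag])
  obtain ⟨w, hw⟩ := hS.exists_of_pos (x := u) (y := v) (i := B) (j := C) (by rwa [hv])
  exact ⟨u, v, w, hv, hw⟩

theorem sum_tripleNumber_right (hS : IsSymmScheme d p) (u v w : V) (l m : Fin (D + 1)) :
    ∑ n, (tripleNumber d u v w l m n : ℤ) = p (d u v) l m := by
  rw [← hS.card, card_eq_sum_card_fiberwise (f := d w) (t := univ) (by simp), Nat.cast_sum]
  simp only [tripleNumber, filter_filter, and_assoc]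

theorem sum_tripleNumber_middle (hS : IsSymmScheme d p) (u v w : V) (l n : Fin (D + 1)) :
    ∑ m, (tripleNumber d u v w l m n : ℤ) = p (d u w) l n := by
  rw [← hS.sum_tripleNumber_right u w v]
  simp only [tripleNumber, and_comm]

theorem sum_tripleNumber_left (hS : IsSymmScheme d p) (u v w : V) (m n : Fin (D + 1)) :
    ∑ l, (tripleNumber d u v w l m n : ℤ) = p (d v w) m n := by
  rw [← hS.sum_tripleNumber_right v w u]
  simp only [tripleNumber, and_comm, and_left_comm]

/-- The hypotheses say that the matrices `f (d x y)`, `g (d x y)`, `e (d x y)` are multiples of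
idempotents, and `h0` that the corresponding Krein parameter vanishes. The squares of the triple
sums, added over all `u`, `v`, `w`, give the entry sum of the entrywise product of the three squared
matrices. Idempotency makes this a multiple of `h0`, so every square is zero. -/
theorem sum_mul_tripleNumber_eq_zero (hS : IsSymmScheme d p) {f g e : Fin (D + 1) → ℤ}
    {a b c : ℤ} (hf : ∀ h, ∑ i, ∑ j, p h i j * (f i * f j) = a * f h)
    (hg : ∀ h, ∑ i, ∑ j, p h i j * (g i * g j) = b * g h)
    (he : ∀ h, ∑ i, ∑ j, p h i j * (e i * e j) = c * e h)
    (h0 : ∑ h, p 0 h h * (f h * g h * e h) = 0) (u v w : V) :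
    ∑ l, ∑ m, ∑ n, f l * g m * e n * (tripleNumber d u v w l m n : ℤ) = 0 := by
  have key : ∑ u, ∑ v, ∑ w, (∑ x, f (d u x) * g (d v x) * e (d w x)) ^ 2 = 0 := by
    rw [sum_sum_sum_sq_eq (fun u x => f (d u x)) (fun u x => g (d u x)) (fun u x => e (d u x))]
    have idem : ∀ {r : Fin (D + 1) → ℤ} {s : ℤ},
        (∀ h, ∑ i, ∑ j, p h i j * (r i * r j) = s * r h) →
        ∀ x y, ∑ u, r (d u x) * r (d u y) = s * r (d x y) := fun {r s} hr x y => by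
      rw [← hr, ← hS.sum_apply_apply (fun i j => r i * r j)]
      simp only [hS.symm x, hS.symm y]
    simp only [idem hf, idem hg, idem he]
    refine sum_eq_zero fun x _ => ?_
    rw [hS.sum_apply (fun h => a * f h * (b * g h) * (c * e h)) x]
    calc _ = a * b * c * ∑ h, p 0 h h * (f h * g h * e h) := by
          rw [mul_sum]; exact sum_congr rfl fun h _ => by ring
      _ = 0 := by rw [h0, mul_zero]
  have hz : ∑ x, f (d u x) * g (d v x) * e (d w x) = 0 := by
    rw [sum_eq_zero_iff_of_nonneg fun u _ => by positivity] at key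
    have k1 := key u (mem_univ _)
    rw [sum_eq_zero_iff_of_nonneg fun u _ => by positivity] at k1
    have k2 := k1 v (mem_univ _)
    rw [sum_eq_zero_iff_of_nonneg fun u _ => by positivity] at k2
    exact pow_eq_zero_iff two_ne_zero |>.1 (k2 w (mem_univ _))
  rw [← hz, sum_apply_eq_sum_card_mul (fun x => (d u x, d v x, d w x))
    (fun t => f t.1 * g t.2.1 * e t.2.2), Fintype.sum_prod_type]
  simp only [Fintype.sum_prod_type, Prod.mk.injEq, tripleNumber, mul_comm]

end IsSymmScheme

/-! ### From the intersection array to the association scheme -/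

namespace SimpleGraph

variable {V : Type*} {G : SimpleGraph V} {D : ℕ} {b c : Fin (D + 1) → ℕ}

theorem HasIntersectionArray.dist_lt [Finite V] (hG : G.HasIntersectionArray b c) (x y : V) :
    G.dist x y < D + 1 + 1 := by
  have := hG.connected.nonempty
  have h := dist_le_diam (connected_iff_ediam_ne_top.1 hG.connected) (u := x) (v := y)
  have := hG.diam_eq
  lia

/-- The distance, as an element of `Fin (D + 2)`, in a graph of diameter `D + 1`. -/
noncomputable def HasIntersectionArray.distFin [Finite V] (hG : G.HasIntersectionArray b c)
    (x y : V) : Fin (D + 1 + 1) :=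
  ⟨G.dist x y, hG.dist_lt x y⟩

/-- `t h k` is the number of neighbours at distance `k` from `x` of a vertex at distance `h`
from `x`, in a distance-regular graph with intersection array `{b; c}`. -/
structure IsNeighborTable (b c : Fin (D + 1) → ℕ) (t : Fin (D + 1 + 1) → Fin (D + 1 + 1) → ℤ) :
    Prop where
  up : ∀ i : Fin (D + 1), t i.castSucc i.succ = b i
  down : ∀ i : Fin (D + 1), t i.succ i.castSucc = c i
  far : ∀ h k : Fin (D + 1 + 1), (h : ℕ) + 1 < k ∨ (k : ℕ) + 1 < h → t h k = 0
  total : ∀ h, ∑ k, t h k = b 0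

variable [Fintype V] {t : Fin (D + 1 + 1) → Fin (D + 1 + 1) → ℤ}

open Classical in
theorem HasIntersectionArray.card_adj_dist (hG : G.HasIntersectionArray b c)
    (ht : IsNeighborTable b c t) (x y : V) (k : Fin (D + 1 + 1)) :
    (#{z | G.Adj y z ∧ hG.distFin x z = k} : ℤ) = t (hG.distFin x y) k := by
  have hb : ∀ (i : Fin (D + 1)) (x y : V), hG.distFin x y = i.castSucc →
      (#{z | G.Adj y z ∧ hG.distFin x z = i.succ} : ℤ) = b i := fun i x y h => by
    rw [← hG.card_b i x y (by simpa [distFin, Fin.ext_iff] using h), Set.ncard_eq_toFinset_card']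
    congr 2
    ext z
    simp [distFin, Fin.ext_iff]
  have hc : ∀ (i : Fin (D + 1)) (x y : V), hG.distFin x y = i.succ →
      (#{z | G.Adj y z ∧ hG.distFin x z = i.castSucc} : ℤ) = c i := fun i x y h => by
    rw [← hG.card_c i x y (by simpa [distFin, Fin.ext_iff] using h), Set.ncard_eq_toFinset_card']
    congr 2
    ext z
    simp [distFin, Fin.ext_iff]
  have hne : ∀ k : Fin (D + 1 + 1), k ≠ hG.distFin x y →
      (#{z | G.Adj y z ∧ hG.distFin x z = k} : ℤ) = t (hG.distFin x y) k := by
    intro k hk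
    by_cases hup : (k : ℕ) = (hG.distFin x y : ℕ) + 1
    · obtain ⟨i, rfl⟩ := Fin.exists_succ_eq.2 (show k ≠ 0 by rintro rfl; simp at hup)
      have hi : hG.distFin x y = i.castSucc := by simp [Fin.ext_iff] at hup ⊢; lia
      rw [hb i x y hi, hi, ht.up]
    by_cases hdn : (k : ℕ) + 1 = (hG.distFin x y : ℕ)
    · obtain ⟨i, hi⟩ := Fin.exists_succ_eq.2 (show hG.distFin x y ≠ 0 by
        intro h; simp [h] at hdn)
      have hk : k = i.castSucc := by
        rw [← hi] at hdn; simp [Fin.ext_iff] at hdn ⊢; lia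
      rw [hk, hc i x y hi.symm, ← hi, ht.down]
    rw [ht.far _ _ (by rw [Ne, Fin.ext_iff] at hk; lia), Nat.cast_eq_zero, card_eq_zero,
      filter_eq_empty_iff]
    rintro z - ⟨hz, rfl⟩
    have := hz.diff_dist_adj (u := x)
    rw [Ne, Fin.ext_iff] at hk
    simp only [distFin] at hk hup hdn
    lia
  have htot : ∑ k, (#{z | G.Adj y z ∧ hG.distFin x z = k} : ℤ) = b 0 := by
    rw [← hb 0 y y (by simp [distFin])]
    have : #{z | G.Adj y z ∧ hG.distFin y z = Fin.succ 0} = #{z | G.Adj y z} := by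
      congr 1
      ext z
      simp only [mem_filter, mem_univ, true_and, and_iff_left_iff_imp]
      intro hz
      simpa [distFin, Fin.ext_iff] using hz
    rw [this, card_eq_sum_card_fiberwise (f := hG.distFin x) (t := univ) (by simp), Nat.cast_sum]
    simp only [filter_filter]
  -- The array does not list the neighbours at the same distance; they are what the other distances
  -- leave of the valency.
  by_cases hk : k = hG.distFin x y
  · have h := ht.total (hG.distFin x y)
    rw [← htot, ← add_sum_erase _ _ (mem_univ k), ← add_sum_erase _ _ (mem_univ k),
      sum_congr rfl fun j hj => hne j (hk ▸ ne_of_mem_erase hj)] at h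
    linarith
  · exact hne k hk

/-- A table `p` that satisfies the recurrence of the intersection numbers consists of the
intersection numbers of the association scheme of a distance-regular graph. -/
theorem HasIntersectionArray.isSymmScheme (hG : G.HasIntersectionArray b c)
    {p : Fin (D + 1 + 1) → Fin (D + 1 + 1) → Fin (D + 1 + 1) → ℤ}
    (ht : IsNeighborTable b c fun h k => p h 1 k) (hc : ∀ i, c i ≠ 0)
    (hp0 : ∀ h j, p h 0 j = if h = j then 1 else 0)
    (hp : ∀ h i j, ∑ k, p h 1 k * p k i j = ∑ k, p k 1 i * p h k j) :
    IsSymmScheme hG.distFin p := by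
  classical
  have hsymm : ∀ x y, hG.distFin x y = hG.distFin y x := fun x y => by
    simp [distFin, dist_comm]
  refine ⟨hsymm, fun x => by simp [distFin], fun i j => ?_⟩
  -- Double count of pairs `(x', z)` with `x'` adjacent to `x`, `z` at distance `i` from `x'` and
  -- `j` from `y`.
  have hrec : ∀ (i j : Fin (D + 1 + 1)) (x y : V),
      ∑ x', (if G.Adj x x' then (#{z | hG.distFin x' z = i ∧ hG.distFin y z = j} : ℤ) else 0) =
        ∑ k, p k 1 i * (#{z | hG.distFin x z = k ∧ hG.distFin y z = j} : ℤ) := by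
    intro i j x y
    have h1 : ∀ x', (if G.Adj x x' then (#{z | hG.distFin x' z = i ∧ hG.distFin y z = j} : ℤ)
        else 0) = ∑ z, if hG.distFin y z = j then
          (if G.Adj x x' ∧ hG.distFin z x' = i then 1 else 0) else 0 := fun x' => by
      rw [← Finset.sum_boole]
      split_ifs with h
      · refine sum_congr rfl fun z _ => ?_
        rw [hsymm x' z, ite_and]
        split_ifs <;> simp_all
      · simp [h]
    simp_rw [h1]
    rw [sum_comm]
    have h2 : ∀ z, (∑ x', if hG.distFin y z = j then
          (if G.Adj x x' ∧ hG.distFin z x' = i then (1 : ℤ) else 0) else 0) =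
        if hG.distFin y z = j then p (hG.distFin x z) 1 i else 0 := fun z => by
      split_ifs with h
      · rw [Finset.sum_boole, hG.card_adj_dist ht, hsymm]
      · simp
    simp_rw [h2]
    rw [sum_apply_eq_sum_card_mul (fun z => (hG.distFin x z, hG.distFin y z))
      (fun a => if a.2 = j then p a.1 1 i else 0), Fintype.sum_prod_type]
    refine sum_congr rfl fun k _ => ?_
    simp [mul_comm]
  have main : ∀ (n : ℕ) (hn : n < D + 1 + 1) (i : Fin (D + 1 + 1)), (i : ℕ) ≤ n → ∀ j x y,
      (#{z | hG.distFin x z = i ∧ hG.distFin y z = j} : ℤ) = p (hG.distFin x y) i j := by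
    intro n
    induction n with
    | zero =>
      intro hn i hi j x y
      obtain rfl : i = 0 := by ext; simpa using hi
      have h0 : ∀ z, hG.distFin x z = 0 ↔ x = z := fun z => by
        simp [distFin, Fin.ext_iff, hG.connected.dist_eq_zero_iff]
      simp only [h0, hp0]
      rw [hsymm x y]
      split_ifs with h
      · rw [Nat.cast_eq_one, card_eq_one]
        exact ⟨x, by ext z; simp only [mem_filter, mem_univ, true_and, mem_singleton]; grind⟩
      · rw [Nat.cast_eq_zero, card_eq_zero, filter_eq_empty_iff]
        rintro z - ⟨rfl, hz⟩
        exact h hz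
    | succ n ih =>
      intro hn i hi j x y
      rcases hi.lt_or_eq with hi | hi
      · exact ih (by lia) i (by lia) j x y
      set q : Fin (D + 1) := ⟨n, by lia⟩ with hq
      have hiq : i = q.succ := by ext; simp [hi, hq]
      have h := hrec q.castSucc j x y
      have hl : ∑ x', (if G.Adj x x' then
          (#{z | hG.distFin x' z = q.castSucc ∧ hG.distFin y z = j} : ℤ) else 0) =
          ∑ k, p (hG.distFin x y) 1 k * p k q.castSucc j := by
        have h3 : ∀ x', (if G.Adj x x' then
            (#{z | hG.distFin x' z = q.castSucc ∧ hG.distFin y z = j} : ℤ) else 0) =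
            if G.Adj x x' then p (hG.distFin y x') q.castSucc j else 0 := fun x' => by
          rw [ih (by lia) q.castSucc (by simp [hq]), hsymm x' y]
        simp_rw [h3]
        have h4 := sum_apply_eq_sum_card_mul (fun x' => (decide (G.Adj x x'), hG.distFin y x'))
          (fun a => if a.1 then p a.2 q.castSucc j else 0)
        simp only [decide_eq_true_eq] at h4
        rw [h4, Fintype.sum_prod_type, sum_comm]
        refine sum_congr rfl fun k _ => ?_
        have := hG.card_adj_dist ht y x k
        rw [hsymm] at this
        rw [← this]
        simp
      -- The table obeys the same recurrence as the counts. Terms below `q.succ` agree by induction,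
      -- those above it have coefficient zero, and the one left has the nonzero coefficient `c q`.
      rw [hl, hp, ← sub_eq_zero, ← sum_sub_distrib, sum_eq_single q.succ] at h
      · rw [← mul_sub, mul_eq_zero] at h
        rcases h with h | h
        · have := ht.down q
          exact absurd (by exact_mod_cast this.symm.trans h) (hc q)
        · rw [hiq]; linarith
      · intro k _ hk
        rcases lt_or_ge (k : ℕ) (n + 1) with hkn | hkn
        · rw [ih (by lia) k (by lia), sub_self]
        · have := ht.far k q.castSucc (Or.inr (by
            have : (k : ℕ) ≠ n + 1 := fun hh => hk (by ext; simp [hh, hq])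
            simp [hq]; lia))
          simp [this]
      · simp
  exact fun x y => main i i.2 i le_rfl j x y

end SimpleGraph

/-! ### Linear algebra of triple intersection numbers -/

/-- The properties of the triple intersection numbers `T l m n` of vertices `u`, `v`, `w` with
`A = d u v`, `B = d u w` and `C = d v w` in an association scheme with intersection numbers `p`. -/
structure IsTripleTable {D : ℕ} (p : Fin (D + 1) → Fin (D + 1) → Fin (D + 1) → ℤ)
    (A B C : Fin (D + 1)) (T : Fin (D + 1) → Fin (D + 1) → Fin (D + 1) → ℕ) : Prop where
  right : ∀ l m, ∑ n, (T l m n : ℤ) = p A l m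
  middle : ∀ l n, ∑ m, (T l m n : ℤ) = p B l n
  left : ∀ m n, ∑ l, (T l m n : ℤ) = p C m n
  krein : ∀ {f g e : Fin (D + 1) → ℤ} (a b c : ℤ),
    (∀ h, ∑ i, ∑ j, p h i j * (f i * f j) = a * f h) →
    (∀ h, ∑ i, ∑ j, p h i j * (g i * g j) = b * g h) →
    (∀ h, ∑ i, ∑ j, p h i j * (e i * e j) = c * e h) →
    ∑ h, p 0 h h * (f h * g h * e h) = 0 →
    ∑ l, ∑ m, ∑ n, f l * g m * e n * (T l m n : ℤ) = 0

theorem IsTripleTable.eq_zero {D : ℕ} {p : Fin (D + 1) → Fin (D + 1) → Fin (D + 1) → ℤ}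
    {A B C : Fin (D + 1)} {T : Fin (D + 1) → Fin (D + 1) → Fin (D + 1) → ℕ}
    (hT : IsTripleTable p A B C T) (l m n : Fin (D + 1))
    (h : p A l m = 0 ∨ p B l n = 0 ∨ p C m n = 0) : T l m n = 0 := by
  rcases h with h | h | h
  · have := hT.right l m
    rw [h, sum_eq_zero_iff_of_nonneg fun _ _ => by positivity] at this
    exact_mod_cast this n (mem_univ n)
  · have := hT.middle l n
    rw [h, sum_eq_zero_iff_of_nonneg fun _ _ => by positivity] at this
    exact_mod_cast this m (mem_univ m)
  · have := hT.left m n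
    rw [h, sum_eq_zero_iff_of_nonneg fun _ _ => by positivity] at this
    exact_mod_cast this l (mem_univ l)

theorem IsSymmScheme.isTripleTable {V : Type*} [Fintype V] {D : ℕ} {d : V → V → Fin (D + 1)}
    {p : Fin (D + 1) → Fin (D + 1) → Fin (D + 1) → ℤ} (hS : IsSymmScheme d p) {u v w : V}
    {A B C : Fin (D + 1)} (huv : d u v = A) (huw : d u w = B) (hvw : d v w = C) :
    IsTripleTable p A B C (tripleNumber d u v w) where
  right l m := huv ▸ hS.sum_tripleNumber_right u v w l m
  middle l n := huw ▸ hS.sum_tripleNumber_middle u v w l n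
  left m n := hvw ▸ hS.sum_tripleNumber_left u v w m n
  krein _ _ _ hf hg he h0 := hS.sum_mul_tripleNumber_eq_zero hf hg he h0 u v w

theorem SimpleGraph.HasIntersectionArray.exists_isTripleTable {V : Type*} [Finite V]
    {G : SimpleGraph V} {D : ℕ} {b c : Fin (D + 1) → ℕ} (hG : G.HasIntersectionArray b c)
    {p : Fin (D + 1 + 1) → Fin (D + 1 + 1) → Fin (D + 1 + 1) → ℤ}
    (ht : IsNeighborTable b c fun h k => p h 1 k) (hc : ∀ i, c i ≠ 0)
    (hp0 : ∀ h j, p h 0 j = if h = j then 1 else 0)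
    (hp : ∀ h i j, ∑ k, p h 1 k * p k i j = ∑ k, p k 1 i * p h k j)
    {A B C : Fin (D + 1 + 1)} (hA : 0 < p 0 A A) (hABC : 0 < p A B C) :
    ∃ T, IsTripleTable p A B C T := by
  have := Fintype.ofFinite V
  have := hG.connected.nonempty
  have hS := hG.isSymmScheme ht hc hp0 hp
  obtain ⟨u, v, w, huv, huw, hvw⟩ := hS.exists_triple hA hABC
  exact ⟨_, hS.isTripleTable huv huw hvw⟩

namespace IsTripleTable

variable {D : ℕ} {p : Fin (D + 1) → Fin (D + 1) → Fin (D + 1) → ℤ} {A B C : Fin (D + 1)}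
  {T : Fin (D + 1) → Fin (D + 1) → Fin (D + 1) → ℕ}

theorem le_right (hT : IsTripleTable p A B C T) (l m n : Fin (D + 1)) : T l m n ≤ p A l m := by
  rw [← hT.right l m]
  exact single_le_sum (f := fun n => (T l m n : ℤ)) (fun _ _ => by positivity) (mem_univ n)

/-- A certificate checker: `α`, `β`, `γ` are the multipliers of the three families of marginal
equations, and `κ` is a Krein equation. The total coefficients need checking only where no
intersection number already forces the triple number to be zero. -/
theorem linear_relation (hT : IsTripleTable p A B C T) (α β γ : Fin (D + 1) → Fin (D + 1) → ℤ)
    {κ : Fin (D + 1) → Fin (D + 1) → Fin (D + 1) → ℤ}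
    (hκ : ∑ l, ∑ m, ∑ n, κ l m n * (T l m n : ℤ) = 0)
    (s t : Fin (D + 1) × Fin (D + 1) × Fin (D + 1)) {x y r : ℤ}
    (h : ∀ l m n, p A l m ≠ 0 → p B l n ≠ 0 → p C m n ≠ 0 →
      α l m + β l n + γ m n + κ l m n =
        (if s = (l, m, n) then x else 0) + if t = (l, m, n) then y else 0)
    (hr : ∑ i, ∑ j, (α i j * p A i j + β i j * p B i j + γ i j * p C i j) = r) :
    x * (T s.1 s.2.1 s.2.2 : ℤ) + y * (T t.1 t.2.1 t.2.2 : ℤ) = r := by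
  have hα : ∑ l, ∑ m, ∑ n, α l m * (T l m n : ℤ) = ∑ i, ∑ j, α i j * p A i j := by
    simp only [← mul_sum, hT.right]
  have hβ : ∑ l, ∑ m, ∑ n, β l n * (T l m n : ℤ) = ∑ i, ∑ j, β i j * p B i j := by
    refine sum_congr rfl fun l _ => ?_
    rw [sum_comm]
    simp only [← mul_sum, hT.middle]
  have hγ : ∑ l, ∑ m, ∑ n, γ m n * (T l m n : ℤ) = ∑ i, ∑ j, γ i j * p C i j := by
    rw [sum_comm]
    refine sum_congr rfl fun m _ => ?_
    rw [sum_comm]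
    simp only [← mul_sum, hT.left]
  have hpt : ∀ l m n, (α l m + β l n + γ m n + κ l m n) * (T l m n : ℤ) =
      ((if s = (l, m, n) then x else 0) + if t = (l, m, n) then y else 0) * T l m n := by
    intro l m n
    by_cases h0 : p A l m = 0 ∨ p B l n = 0 ∨ p C m n = 0
    · rw [hT.eq_zero l m n h0, Nat.cast_zero, mul_zero, mul_zero]
    · push Not at h0
      rw [h l m n h0.1 h0.2.1 h0.2.2]
  have hsingle : ∀ (s : Fin (D + 1) × Fin (D + 1) × Fin (D + 1)) (x : ℤ),
      ∑ l, ∑ m, ∑ n, (if s = (l, m, n) then x else 0) * (T l m n : ℤ) =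
        x * (T s.1 s.2.1 s.2.2 : ℤ) := by
    rintro ⟨a, b, c⟩ x
    simp [ite_and, Prod.mk.injEq]
  have hsum : ∑ l, ∑ m, ∑ n, (α l m + β l n + γ m n + κ l m n) * (T l m n : ℤ) = r := by
    simp only [add_mul, sum_add_distrib] at hr ⊢
    rw [hα, hβ, hγ, hκ, add_zero, hr]
  simp only [hpt] at hsum
  simp only [add_mul, sum_add_distrib, hsingle] at hsum
  exact hsum

end IsTripleTable

theorem sum_mul_add_eq_zero {ι : Type*} [Fintype ι] {κ κ' T : ι → ι → ι → ℤ}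
    (h : ∑ l, ∑ m, ∑ n, κ l m n * T l m n = 0) (h' : ∑ l, ∑ m, ∑ n, κ' l m n * T l m n = 0) :
    ∑ l, ∑ m, ∑ n, (κ l m n + κ' l m n) * T l m n = 0 := by
  simp only [add_mul, sum_add_distrib, h, h', add_zero]

/-! ### Numerical tables and certificates -/

/-- The intersection numbers of the array `{83, 54, 21; 1, 6, 63}`. -/
def intersectionNumbers_83_54_21 : Fin 4 → Fin 4 → Fin 4 → ℤ :=
  ![![![1, 0, 0, 0], ![0, 83, 0, 0], ![0, 0, 747, 0], ![0, 0, 0, 249]], ![![0, 1, 0, 0], ![1, 28,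
  54, 0], ![0, 54, 504, 189], ![0, 0, 189, 60]], ![![0, 0, 1, 0], ![0, 6, 56, 21], ![1, 56, 522,
  168], ![0, 21, 168, 60]], ![![0, 0, 0, 1], ![0, 0, 63, 20], ![0, 63, 504, 180], ![1, 20, 180,
  48]]]

theorem IsTripleTable.relation_83_54_21 {T : Fin 4 → Fin 4 → Fin 4 → ℕ}
    (hT : IsTripleTable (D := 3) intersectionNumbers_83_54_21 1 1 2 T) :
    360 * (T 2 3 3 : ℤ) + 9000 * (T 2 1 1 : ℤ) = -5400 := by
  -- Each vector lists the entries of an idempotent by distance, scaled to integers.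
  have k := hT.krein (f := ![83, -7, 3, -7]) (g := ![83, 29, -1, -7])
    (e := ![83, 29, -1, -7]) (360) (1080) (1080) (by decide +kernel) (by decide +kernel)
    (by decide +kernel) (by decide +kernel)
  exact hT.linear_relation
    (![![0, 0, 0, 0], ![0, -300, 0, 0], ![0, 0, 0, -11], ![0, 0, 0, 49]])
    (![![0, -76280, 0, 0], ![0, -290, 0, 0], ![0, 0, -10, -70], ![0, 0, 0, 0]])
    (![![0, 0, -581, 0], ![0, 6477, 97, 679], ![-581, 87, 7, 49], ![0, 620, 0, 294]])
    k (2, 3, 3) (2, 1, 1) (by decide +kernel) (by decide +kernel)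

/-- The intersection numbers of the array `{125, 108, 24; 1, 9, 75}`. -/
def intersectionNumbers_125_108_24 : Fin 4 → Fin 4 → Fin 4 → ℤ :=
  ![![![1, 0, 0, 0], ![0, 125, 0, 0], ![0, 0, 1500, 0], ![0, 0, 0, 480]], ![![0, 1, 0, 0], ![1,
  16, 108, 0], ![0, 108, 1104, 288], ![0, 0, 288, 192]], ![![0, 0, 1, 0], ![0, 9, 92, 24], ![1,
  92, 1071, 336], ![0, 24, 336, 120]], ![![0, 0, 0, 1], ![0, 0, 75, 50], ![0, 75, 1050, 375],
  ![1, 50, 375, 54]]]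

theorem IsTripleTable.relation_125_108_24 {T : Fin 4 → Fin 4 → Fin 4 → ℕ}
    (hT : IsTripleTable (D := 3) intersectionNumbers_125_108_24 1 1 1 T) :
    3240 * (T 1 1 1 : ℤ) = 4860 := by
  -- The weights 3 and -2 of the two Krein equations are absorbed into `f`, so that they can simply
  -- be added.
  have k1 := hT.krein (f := ![75, 21, 3, -15]) (g := ![25, 7, 1, -5])
    (e := ![25, 7, 1, -5]) (2430) (810) (810) (by decide +kernel) (by decide +kernel)
    (by decide +kernel) (by decide +kernel)
  have k2 := hT.krein (f := ![-50, -14, -2, 10]) (g := ![25, 7, 1, -5])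
    (e := ![400, -32, 4, -5]) (-1620) (810) (810) (by decide +kernel) (by decide +kernel)
    (by decide +kernel) (by decide +kernel)
  simpa using hT.linear_relation
    (![![0, 0, 0, 0], ![-14370, 210, 0, 0], ![0, 35, 5, -25], ![0, 0, -25, 125]])
    (![![0, -14245, 0, 0], ![35315, -505, 35, 0], ![0, 0, 0, 0], ![0, 0, 0, 0]])
    (![![0, 0, 0, 0], ![0, -630, 0, 0], ![0, -90, 0, 0], ![0, 0, 0, 0]])
    -- Only one triple number survives; `(0, 0, 0)` is a dummy with coefficient zero.
    (sum_mul_add_eq_zero k1 k2) (1, 1, 1) (0, 0, 0) (x := 3240) (y := 0) (r := 4860)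
    (by decide +kernel) (by decide +kernel)

/-- The intersection numbers of the array `{195, 160, 28; 1, 20, 168}`. -/
def intersectionNumbers_195_160_28 : Fin 4 → Fin 4 → Fin 4 → ℤ :=
  ![![![1, 0, 0, 0], ![0, 195, 0, 0], ![0, 0, 1560, 0], ![0, 0, 0, 260]], ![![0, 1, 0, 0], ![1,
  34, 160, 0], ![0, 160, 1176, 224], ![0, 0, 224, 36]], ![![0, 0, 1, 0], ![0, 20, 147, 28], ![1,
  147, 1216, 196], ![0, 28, 196, 36]], ![![0, 0, 0, 1], ![0, 0, 168, 27], ![0, 168, 1176, 216],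
  ![1, 27, 216, 16]]]

theorem IsTripleTable.relation_195_160_28 {T : Fin 4 → Fin 4 → Fin 4 → ℕ}
    (hT : IsTripleTable (D := 3) intersectionNumbers_195_160_28 1 3 3 T) :
    11664 * (T 1 1 3 : ℤ) + (-3600) * (T 3 3 2 : ℤ) = -82656 := by
  have k := hT.krein (f := ![-195, -35, 1, 21]) (g := ![195, 35, -1, -21])
    (e := ![65, -7, 2, -7]) (-2016) (2016) (504) (by decide +kernel) (by decide +kernel)
    (by decide +kernel) (by decide +kernel)
  exact hT.linear_relation
    (![![0, -48090, 0, 0], ![0, 2450, -79, 0], ![0, -70, -7, -147], ![0, 0, -147, -3087]])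
    (![![0, 0, 0, 0], ![0, 0, 0, 324], ![0, 0, 0, 0], ![0, 0, 180, 0]])
    (![![0, 0, 0, -48099], ![0, 0, 0, 315], ![0, 0, 9, 0], ![31752, 0, 189, 0]])
    k (1, 1, 3) (3, 3, 2) (by decide +kernel) (by decide +kernel)

/-- The intersection numbers of the array `{126, 90, 10; 1, 6, 105}`. -/
def intersectionNumbers_126_90_10 : Fin 4 → Fin 4 → Fin 4 → ℤ :=
  ![![![1, 0, 0, 0], ![0, 126, 0, 0], ![0, 0, 1890, 0], ![0, 0, 0, 180]], ![![0, 1, 0, 0], ![1,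
  35, 90, 0], ![0, 90, 1650, 150], ![0, 0, 150, 30]], ![![0, 0, 1, 0], ![0, 6, 110, 10], ![1,
  110, 1619, 160], ![0, 10, 160, 10]], ![![0, 0, 0, 1], ![0, 0, 105, 21], ![0, 105, 1680, 105],
  ![1, 21, 105, 53]]]

theorem IsTripleTable.relation_126_90_10 {T : Fin 4 → Fin 4 → Fin 4 → ℕ}
    (hT : IsTripleTable (D := 3) intersectionNumbers_126_90_10 1 1 2 T) :
    19773 * (T 3 3 3 : ℤ) + 8788 * (T 2 1 1 : ℤ) = 21970 := by
  have k := hT.krein (f := ![-180, -50, 2, 15]) (g := ![126, 9, -4, 35])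
    (e := ![126, 9, -4, 35]) (-2197) (2197) (2197) (by decide +kernel) (by decide +kernel)
    (by decide +kernel) (by decide +kernel)
  exact hT.linear_relation
    (![![0, 5954, 0, 0], ![-25200, -1872, 832, 0], ![0, 0, 0, 280], ![0, 0, 0, 2308]])
    (![![0, 0, 0, 0], ![0, -2704, 0, 0], ![0, 0, 0, -630], ![0, 0, -208, 1190]])
    (![![0, 0, 0, 0], ![0, 8626, 72, 0], ![-26032, 72, -32, 910], ![0, -910, 0, -2100]])
    k (3, 3, 3) (2, 1, 1) (by decide +kernel) (by decide +kernel)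

/-- The intersection numbers of the array `{203, 160, 34; 1, 16, 170}`. -/
def intersectionNumbers_203_160_34 : Fin 4 → Fin 4 → Fin 4 → ℤ :=
  ![![![1, 0, 0, 0], ![0, 203, 0, 0], ![0, 0, 2030, 0], ![0, 0, 0, 406]], ![![0, 1, 0, 0], ![1,
  42, 160, 0], ![0, 160, 1530, 340], ![0, 0, 340, 66]], ![![0, 0, 1, 0], ![0, 16, 153, 34], ![1,
  153, 1570, 306], ![0, 34, 306, 66]], ![![0, 0, 0, 1], ![0, 0, 170, 33], ![0, 170, 1530, 330],
  ![1, 33, 330, 42]]]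

theorem IsTripleTable.relation_203_160_34 {T : Fin 4 → Fin 4 → Fin 4 → ℕ}
    (hT : IsTripleTable (D := 3) intersectionNumbers_203_160_34 1 2 2 T) :
    42592 * (T 1 1 2 : ℤ) + 5632 * (T 3 3 2 : ℤ) = 1579776 := by
  have k := hT.krein (f := ![203, 43, -1, -17]) (g := ![203, 43, -1, -17])
    (e := ![203, -17, 5, -17]) (2640) (2640) (1320) (by decide +kernel) (by decide +kernel)
    (by decide +kernel) (by decide +kernel)
  exact hT.linear_relation
    (![![0, 0, 0, 0], ![0, 31433, -731, 0], ![0, -731, 17, 289], ![0, 0, 289, 4913]])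
    (![![0, 0, -44591, 0], ![0, 0, 968, 0], ![0, 0, 0, 0], ![0, 0, -352, 0]])
    (![![0, 0, -44613, 0], ![0, 0, 946, 0], ![-220, 0, -22, 0], ![0, 0, -374, 0]])
    k (1, 1, 2) (3, 3, 2) (by decide +kernel) (by decide +kernel)

/-- The intersection numbers of the array `{53, 40, 28, 16; 1, 4, 10, 28}`. -/
def intersectionNumbers_53_40_28_16 : Fin 5 → Fin 5 → Fin 5 → ℤ :=
  ![![![1, 0, 0, 0, 0], ![0, 53, 0, 0, 0], ![0, 0, 530, 0, 0], ![0, 0, 0, 1484, 0], ![0, 0, 0, 0,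
  848]], ![![0, 1, 0, 0, 0], ![1, 12, 40, 0, 0], ![0, 40, 210, 280, 0], ![0, 0, 280, 756, 448],
  ![0, 0, 0, 448, 400]], ![![0, 0, 1, 0, 0], ![0, 4, 21, 28, 0], ![1, 21, 144, 252, 112], ![0,
  28, 252, 756, 448], ![0, 0, 112, 448, 288]], ![![0, 0, 0, 1, 0], ![0, 0, 10, 27, 16], ![0, 10,
  90, 270, 160], ![1, 27, 270, 754, 432], ![0, 16, 160, 432, 240]], ![![0, 0, 0, 0, 1], ![0, 0,
  0, 28, 25], ![0, 0, 70, 280, 180], ![0, 28, 280, 756, 420], ![1, 25, 180, 420, 222]]]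

theorem IsTripleTable.relation_53_40_28_16 {T : Fin 5 → Fin 5 → Fin 5 → ℕ}
    (hT : IsTripleTable (D := 4) intersectionNumbers_53_40_28_16 1 3 4 T) :
    104976 * (T 2 2 2 : ℤ) + (-524880) * (T 1 1 3 : ℤ) = -787320 := by
  -- Again `f` carries the weights, here 15, 6, 25 and 45. The first and fourth equations come from
  -- the same Krein parameter with the roles of `v` and `w` exchanged.
  have k1 := hT.krein (f := ![795, 435, 165, -15, -105]) (g := ![53, 29, 11, -1, -7])
    (e := ![424, -56, 16, -8, 7]) (43740) (2916) (1458) (by decide +kernel) (by decide +kernel)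
    (by decide +kernel) (by decide +kernel)
  have k2 := hT.krein (f := ![318, 174, 66, -6, -42]) (g := ![265, 55, -8, -5, 10])
    (e := ![424, -56, 16, -8, 7]) (17496) (1458) (1458) (by decide +kernel) (by decide +kernel)
    (by decide +kernel) (by decide +kernel)
  have k3 := hT.krein (f := ![1325, 725, 275, -25, -175]) (g := ![742, -14, -14, 13, -14])
    (e := ![53, 29, 11, -1, -7]) (72900) (1458) (2916) (by decide +kernel) (by decide +kernel)
    (by decide +kernel) (by decide +kernel)
  have k4 := hT.krein (f := ![2385, 1305, 495, -45, -315]) (g := ![424, -56, 16, -8, 7])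
    (e := ![53, 29, 11, -1, -7]) (131220) (1458) (2916) (by decide +kernel) (by decide +kernel)
    (by decide +kernel) (by decide +kernel)
  exact hT.linear_relation
    (![![0, 120000, 0, 0, 0], ![7103376, -520754, 0, 0, 0], ![0, 0, 30866, 12155, 0], ![0, 0,
    -1701, 0, 0], ![0, 0, 0, 0, 0]])
    (![![0, 0, 0, 0, 0], ![0, 0, -181066, 37874, 51359], ![0, -28710, 0, -16500, -11385],
    ![-20935, 1505, -1105, 395, -70], ![0, 10535, -7735, 2765, -490]])
    (![![0, 0, 0, 0, 0], ![0, 0, 0, 52250, -268510], ![0, 0, 8748, 0, 0], ![0, 0, 0, 0, 0], ![0,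
    0, 0, 0, 0]])
    (sum_mul_add_eq_zero (sum_mul_add_eq_zero (sum_mul_add_eq_zero k1 k2) k3) k4)
    (2, 2, 2) (1, 1, 3) (by decide +kernel) (by decide +kernel)

/-- The intersection numbers of the array `{104, 70, 25; 1, 7, 80}`. -/
def intersectionNumbers_104_70_25 : Fin 4 → Fin 4 → Fin 4 → ℤ :=
  ![![![1, 0, 0, 0], ![0, 104, 0, 0], ![0, 0, 1040, 0], ![0, 0, 0, 325]], ![![0, 1, 0, 0], ![1,
  33, 70, 0], ![0, 70, 720, 250], ![0, 0, 250, 75]], ![![0, 0, 1, 0], ![0, 7, 72, 25], ![1, 72,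
  742, 225], ![0, 25, 225, 75]], ![![0, 0, 0, 1], ![0, 0, 80, 24], ![0, 80, 720, 240], ![1, 24,
  240, 60]]]

theorem IsTripleTable.relation_104_70_25 {T : Fin 4 → Fin 4 → Fin 4 → ℕ}
    (hT : IsTripleTable (D := 3) intersectionNumbers_104_70_25 1 1 1 T) :
    8575 * (T 1 2 1 : ℤ) + (-343) * (T 3 3 3 : ℤ) = 145775 := by
  have k := hT.krein (f := ![104, 34, -1, -8]) (g := ![104, 34, -1, -8])
    (e := ![65, -5, 2, -5]) (1470) (1470) (294) (by decide +kernel) (by decide +kernel)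
    (by decide +kernel) (by decide +kernel)
  exact hT.linear_relation
    (![![0, 17925, 0, 0], ![9343, -2312, 68, 0], ![0, 75, 5, 0], ![0, 0, 0, -103]])
    (![![0, 0, 0, 0], ![0, 8337, 0, 0], ![0, 0, -7, 0], ![0, 0, -16, 40]])
    (![![0, 0, 0, 0], ![-72828, -245, 0, 0], ![0, 0, 0, 0], ![0, 0, -9, 40]])
    k (1, 2, 1) (3, 3, 3) (by decide +kernel) (by decide +kernel)

/-! ### Contradiction for each array -/

theorem not_hasIntersectionArray_83_54_21 {V : Type*} [Finite V] (G : SimpleGraph V) :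
    ¬ G.HasIntersectionArray ![83, 54, 21] ![1, 6, 63] := by
  intro hG
  obtain ⟨T, hT⟩ := hG.exists_isTripleTable (p := intersectionNumbers_83_54_21)
    (A := 1) (B := 1) (C := 2)
    ⟨by decide +kernel, by decide +kernel, by decide +kernel, by decide +kernel⟩
    (by decide +kernel) (by decide +kernel) (by decide +kernel) (by decide +kernel)
    (by decide +kernel)
  have h := IsTripleTable.relation_83_54_21 hT
  -- Nonnegative terms cannot have a negative sum.
  lia

theorem not_hasIntersectionArray_195_160_28 {V : Type*} [Finite V] (G : SimpleGraph V) :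
    ¬ G.HasIntersectionArray ![195, 160, 28] ![1, 20, 168] := by
  intro hG
  obtain ⟨T, hT⟩ := hG.exists_isTripleTable (p := intersectionNumbers_195_160_28)
    (A := 1) (B := 3) (C := 3)
    ⟨by decide +kernel, by decide +kernel, by decide +kernel, by decide +kernel⟩
    (by decide +kernel) (by decide +kernel) (by decide +kernel) (by decide +kernel)
    (by decide +kernel)
  have h := IsTripleTable.relation_195_160_28 hT
  -- Divided by 144, the relation is 81a - 25b = -574, so a ≡ 21 mod 25 and b ≥ 91.
  have h' : (T 3 3 2 : ℤ) ≤ 36 := hT.le_right 3 3 2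
  lia

theorem not_hasIntersectionArray_125_108_24 {V : Type*} [Finite V] (G : SimpleGraph V) :
    ¬ G.HasIntersectionArray ![125, 108, 24] ![1, 9, 75] := by
  intro hG
  obtain ⟨T, hT⟩ := hG.exists_isTripleTable (p := intersectionNumbers_125_108_24)
    (A := 1) (B := 1) (C := 1)
    ⟨by decide +kernel, by decide +kernel, by decide +kernel, by decide +kernel⟩
    (by decide +kernel) (by decide +kernel) (by decide +kernel) (by decide +kernel)
    (by decide +kernel)
  have h := IsTripleTable.relation_125_108_24 hT
  -- The triple number would be 3/2.
  lia

theorem not_hasIntersectionArray_126_90_10 {V : Type*} [Finite V] (G : SimpleGraph V) :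
    ¬ G.HasIntersectionArray ![126, 90, 10] ![1, 6, 105] := by
  intro hG
  obtain ⟨T, hT⟩ := hG.exists_isTripleTable (p := intersectionNumbers_126_90_10)
    (A := 1) (B := 1) (C := 2)
    ⟨by decide +kernel, by decide +kernel, by decide +kernel, by decide +kernel⟩
    (by decide +kernel) (by decide +kernel) (by decide +kernel) (by decide +kernel)
    (by decide +kernel)
  have h := IsTripleTable.relation_126_90_10 hT
  -- Divided by 2197: 9a + 4b = 10.
  lia

theorem not_hasIntersectionArray_203_160_34 {V : Type*} [Finite V] (G : SimpleGraph V) :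
    ¬ G.HasIntersectionArray ![203, 160, 34] ![1, 16, 170] := by
  intro hG
  obtain ⟨T, hT⟩ := hG.exists_isTripleTable (p := intersectionNumbers_203_160_34)
    (A := 1) (B := 2) (C := 2)
    ⟨by decide +kernel, by decide +kernel, by decide +kernel, by decide +kernel⟩
    (by decide +kernel) (by decide +kernel) (by decide +kernel) (by decide +kernel)
    (by decide +kernel)
  have h := IsTripleTable.relation_203_160_34 hT
  -- Divided by 352: 121a + 16b = 4488, whose only nonnegative solutions have b = 99 or b = 220.
  have h' : (T 3 3 2 : ℤ) ≤ 66 := hT.le_right 3 3 2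
  lia

theorem not_hasIntersectionArray_53_40_28_16 {V : Type*} [Finite V] (G : SimpleGraph V) :
    ¬ G.HasIntersectionArray ![53, 40, 28, 16] ![1, 4, 10, 28] := by
  intro hG
  obtain ⟨T, hT⟩ := hG.exists_isTripleTable (p := intersectionNumbers_53_40_28_16)
    (A := 1) (B := 3) (C := 4)
    ⟨by decide +kernel, by decide +kernel, by decide +kernel, by decide +kernel⟩
    (by decide +kernel) (by decide +kernel) (by decide +kernel) (by decide +kernel)
    (by decide +kernel)
  have h := IsTripleTable.relation_53_40_28_16 hT
  -- Divided by 52488: 2a - 10b = -15, impossible by parity.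
  lia

theorem not_hasIntersectionArray_104_70_25 {V : Type*} [Finite V] (G : SimpleGraph V) :
    ¬ G.HasIntersectionArray ![104, 70, 25] ![1, 7, 80] := by
  intro hG
  have := Fintype.ofFinite V
  have := hG.connected.nonempty
  have hS : IsSymmScheme (D := 3) hG.distFin intersectionNumbers_104_70_25 := hG.isSymmScheme
    ⟨by decide +kernel, by decide +kernel, by decide +kernel, by decide +kernel⟩
    (by decide +kernel) (by decide +kernel) (by decide +kernel)
  obtain ⟨d, hd⟩ : ∃ d : V → V → Fin 4, d = hG.distFin := ⟨_, rfl⟩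
  rw [← hd] at hS
  obtain ⟨u, v, -, huv, -⟩ := hS.exists_triple (A := 1) (B := 1) (C := 1) (by decide +kernel)
    (by decide +kernel)
  -- Count the pairs of adjacent vertices in `R × S`.
  let R : Finset V := {x | d u x = 1 ∧ d v x = 1}
  let S : Finset V := {y | d u y = 1 ∧ d v y = 2}
  have hR : (#R : ℤ) = 33 := by rw [hS.card, huv]; decide +kernel
  have hS' : (#S : ℤ) = 70 := by rw [hS.card, huv]; decide +kernel
  -- Divided by 343, the relation is 25a - b = 425 with b ≥ 0, hence a ≥ 17.
  have hlow : ∀ x ∈ R, 17 ≤ #(bipartiteAbove (fun x y => d x y = 1) S x) := by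
    intro x hx
    obtain ⟨hux, hvx⟩ : d u x = 1 ∧ d v x = 1 := by simpa [R] using hx
    have h := IsTripleTable.relation_104_70_25 (hS.isTripleTable huv hux hvx)
    have : #(bipartiteAbove (fun x y => d x y = 1) S x) = tripleNumber d u v x 1 2 1 := by
      simp only [bipartiteAbove, S, filter_filter, tripleNumber, and_assoc]
    lia
  -- Neighbours of `y` in `R` are common neighbours of `v` and `y`, of which there are c₂ = 7.
  have hupp : ∀ y ∈ S, #(bipartiteBelow (fun x y => d x y = 1) R y) ≤ 7 := by
    intro y hy
    obtain ⟨-, hvy⟩ : d u y = 1 ∧ d v y = 2 := by simpa [S] using hy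
    have h := hS.card 1 1 v y
    rw [hvy, show intersectionNumbers_104_70_25 2 1 1 = 7 from rfl] at h
    have h7 : #{x | d v x = 1 ∧ d y x = 1} = 7 := by exact_mod_cast h
    rw [← h7]
    refine card_le_card fun x hx => ?_
    simp only [bipartiteBelow, R, mem_filter, mem_univ, true_and] at hx ⊢
    exact ⟨hx.1.2, hS.symm y x ▸ hx.2⟩
  have h1 := card_nsmul_le_sum R _ 17 hlow
  have h2 := sum_le_card_nsmul S _ 7 hupp
  rw [sum_card_bipartiteAbove_eq_sum_card_bipartiteBelow] at h1
  simp only [smul_eq_mul] at h1 h2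
  -- 33 · 17 = 561 exceeds 70 · 7 = 490.
  lia

theorem mainTheorem2 {V : Type*} [Finite V] (G : SimpleGraph V) :
    ¬ G.HasIntersectionArray ![83, 54, 21] ![1, 6, 63] ∧
    ¬ G.HasIntersectionArray ![104, 70, 25] ![1, 7, 80] ∧
    ¬ G.HasIntersectionArray ![195, 160, 28] ![1, 20, 168] ∧
    ¬ G.HasIntersectionArray ![125, 108, 24] ![1, 9, 75] ∧
    ¬ G.HasIntersectionArray ![126, 90, 10] ![1, 6, 105] ∧
    ¬ G.HasIntersectionArray ![203, 160, 34] ![1, 16, 170] ∧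
    ¬ G.HasIntersectionArray ![53, 40, 28, 16] ![1, 4, 10, 28] :=
  ⟨not_hasIntersectionArray_83_54_21 G, not_hasIntersectionArray_104_70_25 G,
    not_hasIntersectionArray_195_160_28 G, not_hasIntersectionArray_125_108_24 G,
    not_hasIntersectionArray_126_90_10 G, not_hasIntersectionArray_203_160_34 G,
    not_hasIntersectionArray_53_40_28_16 G⟩
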